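/- Let $S=\mathbb{C}[u,u^3v^4,uv]\subset\mathbb{C}[u,v]$, and identify a monomial $u^av^b\in S$ with the lattice point $(a,b)\in\mathbb{Z}^2$. Order the monomials of $S$ by $u^{a'}v^{b'}\prec u^av^b$ if and only if $2a'-b'<2a-b$, or $2a'-b'=2a-b$ and $a'+b'<a+b$ (the monomial order given by the weight matrix $\begin{pmatrix}2&-1\\1&1\end{pmatrix}$). Divisibility of monomials always means divisibility in $S$. A finite set $G$ of non-zero elements of an ideal $I\subset S$ is a Gröbner basis of $I$ if the leading monomial of every non-zero $f\in I$ is divisible by the leading monomial of some $g\in G$; it is reduced if every $g\in G$ has leading coefficient $1$ and no monomial occurring in $g$ is divisible by the leading monomial of any other element of $G$. The initial ideal $\mathrm{in}_\preceq(I)$ is the ideal of $S$ generated by the leading monomials of the non-zero elements of $I$. For each integer $n>0$ put $J_n=\langle u-1,\;u^3v^4-1,\;uv-1\rangle^{n+1}\subset S$, and let $\mathcal{P}_n$ be the set of the following lattice points. If $n$ is odd: $p_n=\left(\tfrac{n+3}{2},0\right)$; $q_n^i=\left(\tfrac{n+3}{2},1\right)+\left(\tfrac{n-1}{2}-i\right)(1,2)$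 for $0\le i\le\tfrac{n-1}{2}$; $r_n^j=q_n^0+(0,1)+j(1,2)$ for $0\le j\le\tfrac{n-1}{2}$; $s_n=\tfrac{n+1}{2}(3,4)$. If $n$ is even: $p_n=\left(\tfrac{n+2}{2},0\right)$; $q_n^i=\left(\tfrac{n+2}{2},0\right)+\left(\tfrac{n}{2}-i\right)(1,2)$ for $0\le i\le\tfrac{n-2}{2}$; $r_n^j=q_n^0+(0,1)+j(1,2)$ for $0\le j\le\tfrac{n}{2}$; $s_n=\tfrac{n+2}{2}(3,4)$. Then for every integer $n>0$ the ideal $J_n$ has a unique reduced Gröbner basis with respect to $\preceq$, the set of leading monomials of its elements is exactly $\mathcal{P}_n$, the set $\mathcal{P}_n$ has exactly $n+3$ elements, and $\mathrm{in}_\preceq(J_n)=\langle\mathcal{P}_n\rangle$. -/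

import Mathlib

noncomputable section

namespace NashA3

open MvPolynomial

/-- The polynomial ring `ℂ[u, v]`. -/
abbrev Poly : Type := MvPolynomial (Fin 2) ℂ

/-- The variable `u`. -/
abbrev u : Poly := X 0

/-- The variable `v`. -/
abbrev v : Poly := X 1

/-- The monomial subalgebra `S = ℂ[u, u³v⁴, uv]` of `ℂ[u, v]`. -/
def S : Subalgebra ℂ Poly := Algebra.adjoin ℂ {u, u ^ 3 * v ^ 4, u * v}

/-- `u` as an element of `S`. -/
def genX : S := ⟨u, Algebra.subset_adjoin (by simp)⟩

/-- `u³v⁴` as an element of `S`. -/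
def genY : S := ⟨u ^ 3 * v ^ 4, Algebra.subset_adjoin (by simp)⟩

/-- `uv` as an element of `S`. -/
def genZ : S := ⟨u * v, Algebra.subset_adjoin (by simp)⟩

/-- The ideal `J_n = ⟨u - 1, u³v⁴ - 1, uv - 1⟩ ^ (n + 1)` of `S`. -/
def J (n : ℕ) : Ideal S := Ideal.span {genX - 1, genY - 1, genZ - 1} ^ (n + 1)

/-- The matrix whose rows are the weight vectors `(2, -1)` and `(1, 1)`. -/
def weightMatrix : Matrix (Fin 2) (Fin 2) ℤ := !![2, -1; 1, 1]

/-- The vector of weights of an exponent, in the lexicographic order (first row first). The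
monomial order is: `x^β ≼ x^α` if and only if `weights β ≤ weights α`. -/
def weights (α : Fin 2 →₀ ℕ) : Lex (Fin 2 → ℤ) :=
  toLex (weightMatrix.mulVec fun i => (α i : ℤ))

/-- `x^α` is the leading monomial of `f` (no `α` qualifies when `f = 0`). -/
def IsLeadingExponent (f : S) (α : Fin 2 →₀ ℕ) : Prop :=
  α ∈ (f : Poly).support ∧ ∀ β ∈ (f : Poly).support, weights β ≤ weights α

/-- The monomial `x^α` divides the monomial `x^β` in `S`: the cofactor has to lie in `S`. -/
def MonomialDvd (α β : Fin 2 →₀ ℕ) : Prop :=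
  ∃ h : S, monomial β (1 : ℂ) = monomial α (1 : ℂ) * (h : Poly)

/-- `G` is a Gröbner basis of `I`: a finite set of non-zero elements of `I` such that the leading
monomial of every non-zero element of `I` is divisible in `S` by that of a member of `G`. -/
structure IsGroebnerBasis (I : Ideal S) (G : Set S) : Prop where
  finite : G.Finite
  mem : ∀ g ∈ G, g ∈ I
  ne_zero : ∀ g ∈ G, g ≠ 0
  dvd : ∀ f ∈ I, f ≠ 0 → ∃ g ∈ G, ∃ α β, IsLeadingExponent g α ∧ IsLeadingExponent f β ∧
    MonomialDvd α β

/-- A Gröbner basis is reduced if its members have leading coefficient `1` and no monomial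
occurring in one member is divisible in `S` by the leading monomial of another member. -/
structure IsReducedGroebnerBasis (I : Ideal S) (G : Set S) : Prop extends
    IsGroebnerBasis I G where
  monic : ∀ g ∈ G, ∀ α, IsLeadingExponent g α → coeff α (g : Poly) = 1
  reduced : ∀ g ∈ G, ∀ h ∈ G, h ≠ g → ∀ α, IsLeadingExponent h α →
    ∀ β ∈ (g : Poly).support, ¬ MonomialDvd α β

/-- The lattice point of an exponent. -/
def latticePoint (α : Fin 2 →₀ ℕ) : ℤ × ℤ := (α 0, α 1)

/-- The lattice points of the leading monomials of the members of `G`. -/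
def leadingPoints (G : Set S) : Set (ℤ × ℤ) :=
  {a | ∃ g ∈ G, ∃ α, IsLeadingExponent g α ∧ latticePoint α = a}

/-- The initial ideal, generated in `S` by the leading monomials of the elements of `I`. -/
def initialIdeal (I : Ideal S) : Ideal S :=
  Ideal.span {m : S | ∃ f ∈ I, ∃ α, IsLeadingExponent f α ∧ (m : Poly) = monomial α 1}

/-- The ideal of `S` generated by the monomials of `S` whose lattice point lies in `A`. -/
def monomialIdeal (A : Set (ℤ × ℤ)) : Ideal S :=
  Ideal.span {m : S | ∃ α, latticePoint α ∈ A ∧ (m : Poly) = monomial α 1}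

/-- The point `p_n`. -/
def pPoint (n : ℕ) : ℤ × ℤ :=
  if Odd n then (((n : ℤ) + 3) / 2, 0) else (((n : ℤ) + 2) / 2, 0)

/-- The point `q_n^i`. -/
def qPoint (n : ℕ) (i : ℤ) : ℤ × ℤ :=
  (if Odd n then (((n : ℤ) + 3) / 2, 1) + (((n : ℤ) - 1) / 2) • ((1, 2) : ℤ × ℤ)
    else (((n : ℤ) + 2) / 2, 0) + ((n : ℤ) / 2) • ((1, 2) : ℤ × ℤ)) - i • ((1, 2) : ℤ × ℤ)

/-- The point `r_n^j`. -/
def rPoint (n : ℕ) (j : ℤ) : ℤ × ℤ := qPoint n 0 + (0, 1) + j • ((1, 2) : ℤ × ℤ)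

/-- The point `s_n`. -/
def sPoint (n : ℕ) : ℤ × ℤ :=
  (if Odd n then ((n : ℤ) + 1) / 2 else ((n : ℤ) + 2) / 2) • ((3, 4) : ℤ × ℤ)

/-- The set `P_n` (used for `n > 0`; all divisions by `2` are exact). -/
def P (n : ℕ) : Set (ℤ × ℤ) :=
  {pPoint n}
    ∪ {a | ∃ i : ℤ, 0 ≤ i ∧ i ≤ (if Odd n then ((n : ℤ) - 1) / 2 else ((n : ℤ) - 2) / 2) ∧
        a = qPoint n i}
    ∪ {a | ∃ j : ℤ, 0 ≤ j ∧ j ≤ (if Odd n then ((n : ℤ) - 1) / 2 else (n : ℤ) / 2) ∧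
        a = rPoint n j}
    ∪ {sPoint n}

end NashA3

end

/-!
The point `(1, 1)` is a smooth point of the surface with coordinate ring `S`, and `J n` is the
`(n + 1)`-st power of its maximal ideal; the initial ideal is found by counting the standard
monomials.

The monomials of `S` are the lattice points `(a, b)` of the cone `3b ≤ 4a`, and the order sorts them
by the level `2a - b`, then by `a`. Let `T` be the set of the points that precede `(n + 1, n + 1)`:
the levels `0, …, n` and the part `a ≤ n` of the level `n + 1` (`IsStandard`).

* No non-zero `f ∈ J n` is supported on `T` (`eq_zero_of_support_isStandard`). If `f = ∑ c_α x^α`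
  vanishes to order `n + 1` at `(1, 1)`, then `∑ c_α p(α) = 0` for each polynomial `p` of degree at
  most `n`; for `p` a product of affine forms this follows by applying Euler operators. The lines
  `a - b = 0, 1, -1, 2, -2, …` meet `T` in `n + 1, n, n - 1, …` points, so a product of at most `n`
  affine forms isolates any point of `f` on the last line that `f` meets.
* As `u³v⁴ - 1` is a combination of `u - 1` and `uv - 1`, the products `(u - 1)^i (uv - 1)^j` with
  `i + j ≤ n` span `S` modulo `J n` (`span_products_sup_J`). They are as many as the points of `T`,
  so the monomials of `T` form a basis of the quotient (`exists_sub_standardComb_mem_J`).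

Since `T` is an initial segment, the leading exponents of `J n` are exactly the points of the cone
outside `T`. The set `P n` consists of the minimal ones among them for divisibility in `S`
(`exists_isCorner_add`, `eq_zero_of_isCorner_add`), and the reduced Gröbner basis consists of the
elements `x^ρ - (combination of monomials of T)` of `J n` for `ρ` in `P n`.
-/

namespace NashA3

open MvPolynomial

/-! ### Monomials of `S` and divisibility -/

/-- The lattice points of the monomials of `S`: those with `3b ≤ 4a`. -/
def InCone (α : Fin 2 →₀ ℕ) : Prop := 3 * α 1 ≤ 4 * α 0

theorem InCone.add {α β : Fin 2 →₀ ℕ} (hα : InCone α) (hβ : InCone β) : InCone (α + β) := by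
  unfold InCone at *
  simp only [Finsupp.add_apply]
  omega

/-- The exponent with coordinates `a` and `b`. -/
noncomputable def expo (a b : ℕ) : Fin 2 →₀ ℕ := Finsupp.single 0 a + Finsupp.single 1 b

@[simp] theorem expo_zero (a b : ℕ) : expo a b 0 = a := by simp [expo]

@[simp] theorem expo_one (a b : ℕ) : expo a b 1 = b := by simp [expo]

theorem exponent_ext {α β : Fin 2 →₀ ℕ} (h0 : α 0 = β 0) (h1 : α 1 = β 1) : α = β := by
  ext i
  fin_cases i
  exacts [h0, h1]

theorem monomial_eq_u_pow_mul_v_pow (α : Fin 2 →₀ ℕ) :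
    (monomial α 1 : Poly) = u ^ α 0 * v ^ α 1 := by
  rw [monomial_eq, Finsupp.prod_fintype _ _ (fun i => pow_zero _)]
  simp [Fin.prod_univ_two]

theorem inCone_of_mem_support {f : Poly} (hf : f ∈ S) {α : Fin 2 →₀ ℕ} (hα : α ∈ f.support) :
    InCone α := by
  revert α
  induction hf using Algebra.adjoin_induction with
  | mem x hx =>
    have key : ∀ a b : ℕ, 3 * b ≤ 4 * a → ∀ α ∈ (u ^ a * v ^ b : Poly).support, InCone α := by
      intro a b hab α hα
      have h : (u ^ a * v ^ b : Poly) = monomial (expo a b) 1 := by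
        simp [monomial_eq_u_pow_mul_v_pow]
      rw [h] at hα
      have := Finset.mem_singleton.1 (support_monomial_subset hα)
      subst this
      simpa [InCone] using hab
    intro α hα
    rcases hx with rfl | rfl | rfl
    · exact key 1 0 (by norm_num) α (by simpa using hα)
    · exact key 3 4 (by norm_num) α (by simpa using hα)
    · exact key 1 1 (by norm_num) α (by simpa using hα)
  | algebraMap r =>
    intro α hα
    have := Finset.mem_singleton.1 (support_monomial_subset (s := 0) (a := r) hα)
    subst this
    simp [InCone]
  | add x y _ _ hx hy =>
    intro α hα
    rcases Finset.mem_union.1 (support_add hα) with h | h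
    exacts [hx h, hy h]
  | mul x y _ _ hx hy =>
    intro α hα
    obtain ⟨β, hβ, γ, hγ, rfl⟩ := Finset.mem_add.1 (support_mul x y hα)
    exact (hx hβ).add (hy hγ)

theorem monomial_mem_S {α : Fin 2 →₀ ℕ} (hα : InCone α) : (monomial α 1 : Poly) ∈ S := by
  unfold InCone at hα
  rw [monomial_eq_u_pow_mul_v_pow]
  rcases le_total (α 1) (α 0) with h | h
  · have : (u ^ α 0 * v ^ α 1 : Poly) = (genX ^ (α 0 - α 1) * genZ ^ α 1 : S) := by
      have h0 : α 0 = (α 0 - α 1) + α 1 := by omega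
      conv_lhs => rw [h0]
      simp only [genX, genZ, Subalgebra.coe_mul, Subalgebra.coe_pow, pow_add]
      ring
    rw [this]
    exact Subtype.property _
  · obtain ⟨d, hd⟩ := Nat.exists_eq_add_of_le h
    obtain ⟨e, he⟩ := Nat.exists_eq_add_of_le (show 3 * d ≤ α 0 by omega)
    have : (u ^ α 0 * v ^ α 1 : Poly) = (genY ^ d * genZ ^ e : S) := by
      rw [hd, he]
      simp only [genY, genZ, Subalgebra.coe_mul, Subalgebra.coe_pow]
      ring
    rw [this]
    exact Subtype.property _

/-- The monomial `x^α` as an element of `S`. -/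
noncomputable def mono (α : Fin 2 →₀ ℕ) (hα : InCone α) : S := ⟨monomial α 1, monomial_mem_S hα⟩

theorem monomialDvd_iff {α β : Fin 2 →₀ ℕ} :
    MonomialDvd α β ↔ ∃ γ, InCone γ ∧ β = α + γ := by
  constructor
  · rintro ⟨h, hh⟩
    have h1 := congrArg (coeff β) hh
    rw [coeff_monomial, if_pos rfl, coeff_monomial_mul'] at h1
    split_ifs at h1 with hle
    · refine ⟨β - α, inCone_of_mem_support h.2 ?_, (add_tsub_cancel_of_le hle).symm⟩
      rw [mem_support_iff]
      intro h0
      simp [h0] at h1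
    · simp at h1
  · rintro ⟨γ, hγ, rfl⟩
    exact ⟨mono γ hγ, by simp [mono, monomial_mul]⟩

/-! ### The monomial order -/

theorem weights_lt_iff {α β : Fin 2 →₀ ℕ} :
    weights α < weights β ↔ (2 * α 0 + β 1 < 2 * β 0 + α 1 ∨
      (2 * α 0 + β 1 = 2 * β 0 + α 1 ∧ α 0 + α 1 < β 0 + β 1)) := by
  have h : weights α < weights β ↔ ∃ i, (∀ j < i, weights α j = weights β j) ∧
    weights α i < weights β i := Iff.rfl
  rw [h]
  simp only [Fin.exists_fin_two, weights, weightMatrix, Pi.toLex_apply]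
  simp [Matrix.mulVec, dotProduct, Fin.sum_univ_two]
  omega

theorem weights_injective : Function.Injective weights := by
  intro α β h
  have h1 : ¬ weights α < weights β := h.not_lt
  have h2 : ¬ weights β < weights α := h.not_gt
  rw [weights_lt_iff] at h1 h2
  apply exponent_ext <;> omega

theorem exists_isLeadingExponent {f : S} (hf : f ≠ 0) : ∃ α, IsLeadingExponent f α := by
  have h : (f : Poly).support.Nonempty := by
    rw [support_nonempty]
    simpa using hf
  obtain ⟨α, h1, h2⟩ := Finset.exists_max_image _ weights h
  exact ⟨α, h1, h2⟩

theorem IsLeadingExponent.unique {f : S} {α β : Fin 2 →₀ ℕ} (hα : IsLeadingExponent f α)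
    (hβ : IsLeadingExponent f β) : α = β :=
  weights_injective (le_antisymm (hβ.2 _ hα.1) (hα.2 _ hβ.1))

theorem IsLeadingExponent.inCone {f : S} {α : Fin 2 →₀ ℕ} (hα : IsLeadingExponent f α) :
    InCone α :=
  inCone_of_mem_support f.2 hα.1

theorem weights_lt_add {α γ : Fin 2 →₀ ℕ} (hγ : InCone γ) (h : γ ≠ 0) :
    weights α < weights (α + γ) := by
  have h0 : γ 0 ≠ 0 ∨ γ 1 ≠ 0 := by
    by_contra! h0
    exact h (exponent_ext h0.1 h0.2)
  unfold InCone at hγ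
  simp only [weights_lt_iff, Finsupp.add_apply]
  omega

/-! ### Standard and corner exponents -/

/-- The exponents that precede `(n + 1, n + 1)`, which will turn out to be the standard monomials
of `J n`: all the levels `2a - b = 0, …, n` of the cone, and the points with `a ≤ n` on the level
`n + 1`. -/
def IsStandard (n : ℕ) (α : Fin 2 →₀ ℕ) : Prop :=
  InCone α ∧ (2 * α 0 ≤ α 1 + n ∨ (2 * α 0 = α 1 + n + 1 ∧ α 0 ≤ n))

theorem weights_lt_of_isStandard {n : ℕ} {α β : Fin 2 →₀ ℕ} (hα : IsStandard n α)
    (hβ : InCone β) (hβ' : ¬ IsStandard n β) : weights α < weights β := by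
  unfold IsStandard at *
  rw [weights_lt_iff]
  have : ¬ (2 * β 0 ≤ β 1 + n ∨ (2 * β 0 = β 1 + n + 1 ∧ β 0 ≤ n)) := fun h => hβ' ⟨hβ, h⟩
  omega

theorem not_isStandard_add {n : ℕ} {α γ : Fin 2 →₀ ℕ} (hα : InCone α) (h : ¬ IsStandard n α)
    (hγ : InCone γ) : ¬ IsStandard n (α + γ) := by
  intro hs
  rcases eq_or_ne γ 0 with rfl | h0
  · exact h (by simpa using hs)
  · exact lt_asymm (weights_lt_of_isStandard hs hα h) (weights_lt_add hγ h0)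

/-- The points of `P n` by equations: on the level `2a - b = n + 2` the `q_n^i`, with `p_n` for even
`n`; on the level `n + 1` the `r_n^j`, with `s_n` for odd `n`; then `p_n` for odd `n`, on the level
`n + 3`, and `s_n` for even `n`, on the level `n + 2`. -/
def IsCorner (n : ℕ) (a b : ℤ) : Prop :=
  (b = 2 * a - n - 2 ∧ 0 ≤ b ∧ a ≤ n + 1) ∨ (b = 2 * a - n - 1 ∧ n + 1 ≤ a ∧ 3 * b ≤ 4 * a) ∨
    (n % 2 = 1 ∧ 2 * a = n + 3 ∧ b = 0) ∨ (n % 2 = 0 ∧ 2 * a = 3 * (n + 2) ∧ b = 2 * (n + 2))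

theorem mem_P_iff {n : ℕ} {a b : ℤ} : (a, b) ∈ P n ↔ IsCorner n a b := by
  rcases Nat.even_or_odd n with he | ho
  · have hno : ¬ Odd n := Nat.not_odd_iff_even.2 he
    have h2 : n % 2 = 0 := Nat.even_iff.1 he
    simp only [P, pPoint, qPoint, rPoint, sPoint, hno, if_false, Set.mem_union, Set.mem_ofPred_eq,
      Set.mem_singleton_iff, Prod.ext_iff, Prod.fst_add, Prod.snd_add, Prod.fst_sub,
      Prod.snd_sub, Prod.smul_mk, smul_eq_mul, IsCorner]
    constructor
    · rintro (((h | ⟨i, h⟩) | ⟨i, h⟩) | h) <;> omega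
    · rintro (h | h | h | h)
      · by_cases hb : b = 0
        · exact Or.inl (Or.inl (Or.inl (by omega)))
        · exact Or.inl (Or.inl (Or.inr ⟨n + 1 - a, by omega⟩))
      · exact Or.inl (Or.inr ⟨a - (n + 1), by omega⟩)
      · omega
      · exact Or.inr (by omega)
  · have h2 : n % 2 = 1 := Nat.odd_iff.1 ho
    simp only [P, pPoint, qPoint, rPoint, sPoint, ho, if_true, Set.mem_union, Set.mem_ofPred_eq,
      Set.mem_singleton_iff, Prod.ext_iff, Prod.fst_add, Prod.snd_add, Prod.fst_sub,
      Prod.snd_sub, Prod.smul_mk, smul_eq_mul, IsCorner]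
    constructor
    · rintro (((h | ⟨i, h⟩) | ⟨i, h⟩) | h) <;> omega
    · rintro (h | h | h | h)
      · exact Or.inl (Or.inl (Or.inr ⟨n + 1 - a, by omega⟩))
      · by_cases hb : 3 * b = 4 * a
        · exact Or.inr (by omega)
        · exact Or.inl (Or.inr ⟨a - (n + 1), by omega⟩)
      · exact Or.inl (Or.inl (Or.inl (by omega)))
      · omega

theorem latticePoint_mem_P_iff {n : ℕ} {α : Fin 2 →₀ ℕ} :
    latticePoint α ∈ P n ↔ IsCorner n (α 0) (α 1) := mem_P_iff

theorem exists_latticePoint_eq {n : ℕ} {x : ℤ × ℤ} (hx : x ∈ P n) : ∃ α, latticePoint α = x := by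
  obtain ⟨a, b⟩ := x
  have h := mem_P_iff.1 hx
  unfold IsCorner at h
  refine ⟨expo a.toNat b.toNat, ?_⟩
  simp only [latticePoint, expo_zero, expo_one, Prod.mk.injEq]
  omega

theorem ncard_P (n : ℕ) : (P n).ncard = n + 3 := by
  -- The points of `P n` along the staircase, from `p_n` to `s_n`.
  let g : ℤ → ℤ × ℤ := fun i =>
    if i ≤ n + 1 then (if 2 * i = n + 1 then (i + 1, 0) else (i, 2 * i - n - 2))
    else (if 2 * i = 3 * (n + 2) then (i, 2 * (n + 2)) else (i - 1, 2 * (i - 1) - n - 1))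
  have hP : P n = g '' (Finset.Icc ((n : ℤ) / 2 + 1) ((n : ℤ) / 2 + 1 + n + 2) : Finset ℤ) := by
    ext ⟨a, b⟩
    rw [mem_P_iff]
    simp only [IsCorner, Set.mem_image, Finset.coe_Icc, Set.mem_Icc]
    constructor
    · rintro (h | h | h | h)
      · refine ⟨a, by omega, ?_⟩
        simp only [g]
        split_ifs <;> rw [Prod.mk.injEq] <;> omega
      · refine ⟨a + 1, by omega, ?_⟩
        simp only [g]
        split_ifs <;> rw [Prod.mk.injEq] <;> omega
      · refine ⟨a - 1, by omega, ?_⟩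
        simp only [g]
        split_ifs <;> rw [Prod.mk.injEq] <;> omega
      · refine ⟨a, by omega, ?_⟩
        simp only [g]
        split_ifs <;> rw [Prod.mk.injEq] <;> omega
    · rintro ⟨i, hi, h⟩
      simp only [g] at h
      split_ifs at h <;> rw [Prod.mk.injEq] at h <;> omega
  have hinj : Function.Injective g := by
    intro i j h
    simp only [g] at h
    split_ifs at h <;> rw [Prod.mk.injEq] at h <;> omega
  rw [hP, Set.ncard_image_of_injective _ hinj, Set.ncard_coe_finset, Int.card_Icc]
  omega

theorem inCone_of_isCorner {n : ℕ} {α : Fin 2 →₀ ℕ} (h : IsCorner n (α 0) (α 1)) : InCone α := by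
  unfold IsCorner at h
  unfold InCone
  omega

theorem not_isStandard_of_isCorner {n : ℕ} {α : Fin 2 →₀ ℕ} (h : IsCorner n (α 0) (α 1)) :
    ¬ IsStandard n α := by
  unfold IsCorner at h
  unfold IsStandard
  omega

/-- Every non-standard exponent of the cone is a corner plus an exponent of the cone: a generator
of `S` can be split off without leaving the non-standard exponents, except at the corners. -/
theorem exists_isCorner_add {n : ℕ} {α : Fin 2 →₀ ℕ} (hα : InCone α) (h : ¬ IsStandard n α) :
    ∃ ρ γ : Fin 2 →₀ ℕ, IsCorner n (ρ 0) (ρ 1) ∧ InCone γ ∧ α = ρ + γ := by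
  induction hk : α 0 using Nat.strong_induction_on generalizing α with
  | _ k ih =>
    by_cases hc : IsCorner n (α 0) (α 1)
    · exact ⟨α, 0, hc, by simp [InCone], by simp⟩
    have step : ∀ a b : ℕ, 0 < a → 3 * b ≤ 4 * a → a ≤ α 0 → b ≤ α 1 →
        InCone (expo (α 0 - a) (α 1 - b)) → ¬ IsStandard n (expo (α 0 - a) (α 1 - b)) →
        ∃ ρ γ : Fin 2 →₀ ℕ, IsCorner n (ρ 0) (ρ 1) ∧ InCone γ ∧ α = ρ + γ := by
      intro a b ha hab h0 h1 hβ hβ'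
      obtain ⟨ρ, γ, hρ, hγ, he⟩ := ih (α 0 - a) (by omega) hβ hβ' (by simp)
      have he0 := DFunLike.congr_fun he 0
      have he1 := DFunLike.congr_fun he 1
      simp only [expo_zero, expo_one, Finsupp.add_apply] at he0 he1
      refine ⟨ρ, γ + expo a b, hρ, hγ.add (by simpa [InCone] using hab), exponent_ext ?_ ?_⟩ <;>
        simp only [expo_zero, expo_one, Finsupp.add_apply] <;> omega
    unfold IsStandard InCone at *
    unfold IsCorner at hc
    simp only [expo_zero, expo_one] at step
    by_cases h1 : α 1 = 0
    · exact step 1 0 (by omega) (by omega) (by omega) (by omega) (by omega) (by omega)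
    by_cases h2 : 4 * α 0 = 3 * α 1
    · exact step 3 4 (by omega) (by omega) (by omega) (by omega) (by omega) (by omega)
    · exact step 1 1 (by omega) (by omega) (by omega) (by omega) (by omega) (by omega)

theorem eq_zero_of_isCorner_add {n : ℕ} {α γ : Fin 2 →₀ ℕ} (hα : IsCorner n (α 0) (α 1))
    (hγ : InCone γ) (h : IsCorner n ((α + γ) 0) ((α + γ) 1)) : γ = 0 := by
  unfold IsCorner at *
  unfold InCone at hγ
  simp only [Finsupp.add_apply, Nat.cast_add] at h
  apply exponent_ext <;> simp only [Finsupp.coe_zero, Pi.zero_apply] <;> omega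

/-! ### No non-zero element of `J n` is supported on the standard exponents -/

/-- The ideal of the point `(1, 1)` of the plane. -/
noncomputable def pointIdeal : Ideal Poly := Ideal.span {u - 1, v - 1}

theorem coe_mem_of_mem_J {n : ℕ} {f : S} (hf : f ∈ J n) : (f : Poly) ∈ pointIdeal ^ (n + 1) := by
  have hu : u - 1 ∈ pointIdeal := Ideal.subset_span (by simp)
  have hv : v - 1 ∈ pointIdeal := Ideal.subset_span (by simp)
  have hle : Ideal.span {genX - 1, genY - 1, genZ - 1} ≤ pointIdeal.comap S.val := by
    rw [Ideal.span_le]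
    rintro x (rfl | rfl | rfl)
    · simpa [genX] using hu
    · have : (u ^ 3 * v ^ 4 - 1 : Poly) =
          (u ^ 2 + u + 1) * v ^ 4 * (u - 1) + (v ^ 3 + v ^ 2 + v + 1) * (v - 1) := by ring
      have h : (u ^ 3 * v ^ 4 - 1 : Poly) ∈ pointIdeal := by
        rw [this]
        exact add_mem (Ideal.mul_mem_left _ _ hu) (Ideal.mul_mem_left _ _ hv)
      simpa [genY] using h
    · have : (u * v - 1 : Poly) = v * (u - 1) + (v - 1) := by ring
      have h : (u * v - 1 : Poly) ∈ pointIdeal := by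
        rw [this]
        exact add_mem (Ideal.mul_mem_left _ _ hu) hv
      simpa [genZ] using h
  have h := Ideal.pow_right_mono hle (n + 1) hf
  exact Ideal.le_comap_pow S.val (n + 1) h

theorem eval_eq_zero_of_mem_pointIdeal {f : Poly} (hf : f ∈ pointIdeal) :
    eval (fun _ => (1 : ℂ)) f = 0 := by
  have : pointIdeal ≤ RingHom.ker (eval fun _ : Fin 2 => (1 : ℂ)) := by
    rw [pointIdeal, Ideal.span_le]
    rintro x (rfl | rfl) <;> simp [RingHom.mem_ker]
  exact this hf

theorem derivation_mem_pow {R A : Type*} [CommRing R] [CommRing A] [Algebra R A]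
    (D : Derivation R A A) (I : Ideal A) (m : ℕ) {f : A} (hf : f ∈ I ^ (m + 1)) :
    D f ∈ I ^ m := by
  induction m generalizing f with
  | zero => simp
  | succ m ih =>
    rw [pow_succ] at hf
    induction hf using Submodule.mul_induction_on' with
    | mem_mul_mem a ha b hb =>
      rw [D.leibniz, smul_eq_mul, smul_eq_mul]
      refine add_mem (Ideal.mul_mem_right _ _ ha) ?_
      rw [pow_succ, mul_comm b]
      exact Ideal.mul_mem_mul (ih ha) hb
    | add a _ b _ ha hb =>
      rw [map_add]
      exact add_mem ha hb

/-- The Euler operator of an affine form `x a + y b + z` multiplies each monomial by the value of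
the form at its exponent, and lowers the order of vanishing at `(1, 1)` by at most one. -/
theorem exists_coeff_eq_affine_mul (x y z : ℂ) {m : ℕ} {f : Poly} (hf : f ∈ pointIdeal ^ (m + 1)) :
    ∃ g ∈ pointIdeal ^ m, ∀ α, coeff α g = (x * α 0 + y * α 1 + z) * coeff α f := by
  let D : Derivation ℂ Poly Poly := x • (u • pderiv 0) + y • (v • pderiv 1)
  refine ⟨D f + C z * f, add_mem (derivation_mem_pow D _ _ hf)
    (Ideal.mul_mem_left _ _ (Ideal.pow_le_pow_right (Nat.le_succ m) hf)), fun α => ?_⟩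
  clear hf
  induction f using MvPolynomial.induction_on' with
  | monomial β c =>
    simp only [D, Derivation.add_apply, Derivation.smul_apply, smul_eq_mul, X_mul_pderiv_monomial,
      coeff_add, coeff_smul, coeff_C_mul, coeff_monomial]
    split_ifs with h
    · subst h
      simp only [nsmul_eq_mul]
      ring
    · simp
  | add p q hp hq =>
    rw [map_add, mul_add, add_add_add_comm, coeff_add, hp, hq, coeff_add, mul_add]

theorem exists_coeff_eq_prod_mul {ι : Type*} (s : Finset ι) (x y z : ι → ℂ) {m : ℕ} {f : Poly}
    (hf : f ∈ pointIdeal ^ (m + s.card)) :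
    ∃ g ∈ pointIdeal ^ m, ∀ α,
      coeff α g = (∏ i ∈ s, (x i * α 0 + y i * α 1 + z i)) * coeff α f := by
  classical
  induction s using Finset.induction_on generalizing f with
  | empty => exact ⟨f, by simpa using hf, by simp⟩
  | insert i s hi ih =>
    rw [Finset.card_insert_of_notMem hi, ← add_assoc] at hf
    obtain ⟨g, hg, hgf⟩ := exists_coeff_eq_affine_mul (x i) (y i) (z i) hf
    obtain ⟨k, hk, hkg⟩ := ih hg
    refine ⟨k, hk, fun α => ?_⟩
    rw [hkg, hgf, Finset.prod_insert hi]
    ring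

/-- The lines `a - b = c` sorted as `c = 0, 1, -1, 2, -2, …`: the line of rank `k` contains
`n + 1 - k` standard exponents. -/
def lineRank (α : Fin 2 →₀ ℕ) : ℕ :=
  if α 1 < α 0 then 2 * (α 0 - α 1) - 1 else 2 * (α 1 - α 0)

/-- The standard exponents impose independent conditions on the polynomials of degree at most `n`:
take an exponent of `f` on a line `a - b = c` of maximal rank `k`; the product of the `k` lines of
lower rank and of the `n - k` forms vanishing at the other standard exponents of its line isolates
its coefficient. -/
theorem eq_zero_of_support_isStandard {n : ℕ} {f : Poly} (hf : f ∈ pointIdeal ^ (n + 1))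
    (hs : ∀ α ∈ f.support, IsStandard n α) : f = 0 := by
  by_contra h0
  obtain ⟨τ, hτ, hmax⟩ := Finset.exists_max_image f.support lineRank (support_nonempty.2 h0)
  -- `L` indexes the lines of lower rank, `M` the values of `b` at the other points of the line.
  obtain ⟨L, M, hcard, hLτ, hMτ, hcover⟩ : ∃ L M : Finset ℤ, L.card + M.card = n ∧
      (τ 0 : ℤ) - τ 1 ∉ L ∧ (τ 1 : ℤ) ∉ M ∧ ∀ α : Fin 2 →₀ ℕ, IsStandard n α →
        lineRank α ≤ lineRank τ → α = τ ∨ (α 0 : ℤ) - α 1 ∈ L ∨ (α 1 : ℤ) ∈ M := by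
    have hτs := hs τ hτ
    unfold IsStandard InCone at hτs
    by_cases hlt : τ 1 < τ 0
    -- For `c > 0` the standard exponents on the line have `0 ≤ b ≤ n + 1 - 2c`.
    · refine ⟨Finset.Icc (1 - ((τ 0 : ℤ) - τ 1)) ((τ 0 : ℤ) - τ 1 - 1),
        (Finset.Icc (0 : ℤ) (n + 1 - 2 * ((τ 0 : ℤ) - τ 1))).erase (τ 1), ?_, ?_, ?_, ?_⟩
      · rw [Finset.card_erase_of_mem (by rw [Finset.mem_Icc]; omega), Int.card_Icc, Int.card_Icc]
        omega
      · rw [Finset.mem_Icc]; omega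
      · simp
      · intro α hα hr
        by_cases he : α = τ
        · exact Or.inl he
        right
        have hne : α 0 ≠ τ 0 ∨ α 1 ≠ τ 1 := by
          by_contra! h
          exact he (exponent_ext h.1 h.2)
        unfold IsStandard InCone at hα
        simp only [lineRank] at hr
        rw [Finset.mem_erase, Finset.mem_Icc, Finset.mem_Icc]
        split_ifs at hr <;> omega
    -- For `c ≤ 0` the standard exponents on the line have `-4c ≤ b ≤ n - 2c`.
    · refine ⟨Finset.Icc ((τ 0 : ℤ) - τ 1 + 1) ((τ 1 : ℤ) - τ 0),
        (Finset.Icc (4 * ((τ 1 : ℤ) - τ 0)) (n + 2 * ((τ 1 : ℤ) - τ 0))).erase (τ 1),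
        ?_, ?_, ?_, ?_⟩
      · rw [Finset.card_erase_of_mem (by rw [Finset.mem_Icc]; omega), Int.card_Icc, Int.card_Icc]
        omega
      · rw [Finset.mem_Icc]; omega
      · simp
      · intro α hα hr
        by_cases he : α = τ
        · exact Or.inl he
        right
        have hne : α 0 ≠ τ 0 ∨ α 1 ≠ τ 1 := by
          by_contra! h
          exact he (exponent_ext h.1 h.2)
        unfold IsStandard InCone at hα
        simp only [lineRank] at hr
        rw [Finset.mem_erase, Finset.mem_Icc, Finset.mem_Icc]
        split_ifs at hr <;> omega
  rw [show n + 1 = 1 + M.card + L.card by omega] at hf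
  obtain ⟨g, hg, hgf⟩ := exists_coeff_eq_prod_mul L (fun _ => 1) (fun _ => -1)
    (fun c => -(c : ℂ)) hf
  obtain ⟨k, hk, hkg⟩ := exists_coeff_eq_prod_mul M (fun _ => 0) (fun _ => 1)
    (fun b => -(b : ℂ)) hg
  -- All the other coefficients of `k` vanish, while `k` vanishes at `(1, 1)`.
  have hmono : k = monomial τ (coeff τ k) := by
    ext α
    rw [coeff_monomial]
    split_ifs with h
    · rw [h]
    · by_cases hα : α ∈ f.support
      · rcases hcover α (hs α hα) (hmax α hα) with h' | h' | h'
        · exact absurd h'.symm h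
        · have hgα : coeff α g = 0 := by
            rw [hgf, Finset.prod_eq_zero h' (by push_cast; ring), zero_mul]
          rw [hkg, hgα, mul_zero]
        · rw [hkg, Finset.prod_eq_zero h' (by push_cast; ring), zero_mul]
      · rw [hkg, hgf, notMem_support_iff.1 hα, mul_zero, mul_zero]
  have h1 := eval_eq_zero_of_mem_pointIdeal (by simpa using hk)
  rw [hmono, eval_monomial] at h1
  have h2 : coeff τ k = 0 := by simpa using h1
  rw [hkg, hgf] at h2
  refine mul_ne_zero (Finset.prod_ne_zero_iff.2 fun b hb h => hMτ ?_)
    (mul_ne_zero (Finset.prod_ne_zero_iff.2 fun c hc h => hLτ ?_) (mem_support_iff.1 hτ)) h2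
  · have : ((τ 1 : ℤ) : ℂ) = (b : ℂ) := by push_cast; linear_combination h
    rwa [Int.cast_injective this]
  · have : ((τ 0 - τ 1 : ℤ) : ℂ) = (c : ℂ) := by push_cast; linear_combination h
    rwa [Int.cast_injective this]

/-! ### The quotient of `S` by `J n` -/

theorem span_pair_pow_le {R : Type*} [CommRing R] (a b : R) (k : ℕ) :
    Ideal.span {a, b} ^ k ≤ Ideal.span {m | ∃ i j, i + j = k ∧ m = a ^ i * b ^ j} := by
  induction k with
  | zero =>
    rw [pow_zero, Ideal.one_eq_top, top_le_iff, Ideal.eq_top_iff_one]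
    exact Ideal.subset_span ⟨0, 0, rfl, by simp⟩
  | succ k ih =>
    rw [pow_succ']
    refine (Ideal.mul_mono_right ih).trans ?_
    rw [Ideal.span_mul_span', Ideal.span_le]
    rintro _ ⟨x, hx, _, ⟨i, j, hij, rfl⟩, rfl⟩
    apply Ideal.subset_span
    rcases hx with rfl | rfl
    · exact ⟨i + 1, j, by omega, by simp only; ring⟩
    · exact ⟨i, j + 1, by omega, by simp only; ring⟩

/-- Since `u · u³v⁴ = (uv)⁴`, the generator `u³v⁴ - 1` is redundant. -/
theorem span_generators_eq :
    Ideal.span {genX - 1, genY - 1, genZ - 1} = Ideal.span {genX - 1, genZ - 1} := by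
  have hrel : genX * genY = genZ ^ 4 := by
    apply Subtype.ext
    simp only [genX, genY, genZ, Subalgebra.coe_mul, Subalgebra.coe_pow]
    ring
  apply le_antisymm
  · rw [Ideal.span_le]
    rintro x (rfl | rfl | rfl)
    · exact Ideal.subset_span (by simp)
    · rw [SetLike.mem_coe, Ideal.mem_span_pair]
      exact ⟨-genY, genZ ^ 3 + genZ ^ 2 + genZ + 1, by linear_combination -hrel⟩
    · exact Ideal.subset_span (by simp)
  · exact Ideal.span_mono (by intro x; simp; tauto)

theorem exists_sub_algebraMap_mem (f : S) :
    ∃ c : ℂ, f - algebraMap ℂ S c ∈ Ideal.span {genX - 1, genZ - 1} := by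
  rw [← span_generators_eq]
  obtain ⟨f, hf⟩ := f
  induction hf using Algebra.adjoin_induction with
  | mem x hx =>
    refine ⟨1, ?_⟩
    rw [map_one]
    apply Ideal.subset_span
    rcases hx with rfl | rfl | rfl
    · exact Or.inl rfl
    · exact Or.inr (Or.inl rfl)
    · exact Or.inr (Or.inr rfl)
  | algebraMap r =>
    refine ⟨r, ?_⟩
    convert Ideal.zero_mem _
    exact sub_self (algebraMap ℂ S r)
  | add x y hx hy h1 h2 =>
    obtain ⟨c, hc⟩ := h1
    obtain ⟨d, hd⟩ := h2
    refine ⟨c + d, ?_⟩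
    have := add_mem hc hd
    convert this using 1
    change (⟨x, hx⟩ + ⟨y, hy⟩ : S) - _ = _
    rw [map_add]
    ring
  | mul x y hx hy h1 h2 =>
    obtain ⟨c, hc⟩ := h1
    obtain ⟨d, hd⟩ := h2
    refine ⟨c * d, ?_⟩
    have := add_mem (Ideal.mul_mem_right (⟨y, hy⟩ : S) _ hc)
      (Ideal.mul_mem_left _ (algebraMap ℂ S c) hd)
    convert this using 1
    change (⟨x, hx⟩ * ⟨y, hy⟩ : S) - _ = _
    rw [map_mul]
    ring

/-- The pairs `(i, j)` with `i + j ≤ n`. -/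
abbrev Triangle (n : ℕ) : Type := {d : Fin (n + 1) × Fin (n + 1) // (d.1 : ℕ) + d.2 ≤ n}

/-- The products `(u - 1)^i (uv - 1)^j` with `i + j ≤ n` span `S` modulo `J n`. -/
theorem span_products_sup_J (n : ℕ) :
    Submodule.span ℂ (Set.range fun d : Triangle n =>
      (genX - 1) ^ (d.1.1 : ℕ) * (genZ - 1) ^ (d.1.2 : ℕ)) ⊔ (J n).restrictScalars ℂ = ⊤ := by
  rw [J, span_generators_eq]
  set I : Ideal S := Ideal.span {genX - 1, genZ - 1} with hI
  set V := Submodule.span ℂ (Set.range fun d : Triangle n =>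
      (genX - 1) ^ (d.1.1 : ℕ) * (genZ - 1) ^ (d.1.2 : ℕ)) with hV
  have key : ∀ k ≤ n + 1, V ⊔ (I ^ k).restrictScalars ℂ = ⊤ := by
    intro k
    induction k with
    | zero => intro _; rw [pow_zero, Ideal.one_eq_top]; simp
    | succ k ih =>
      intro hk
      rw [← top_le_iff, ← ih (by omega)]
      refine sup_le le_sup_left ?_
      intro f hf
      have hf' := span_pair_pow_le _ _ k hf
      have hI' : Ideal.span {m | ∃ i j, i + j = k ∧ m = (genX - 1) ^ i * (genZ - 1) ^ j} ≤
          I ^ k := by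
        rw [Ideal.span_le]
        rintro x ⟨i, j, rfl, rfl⟩
        rw [SetLike.mem_coe, pow_add]
        exact Ideal.mul_mem_mul (Ideal.pow_mem_pow (Ideal.subset_span (by simp)) i)
          (Ideal.pow_mem_pow (Ideal.subset_span (by simp)) j)
      clear hf
      refine Submodule.closure_induction (p := fun f _ => f ∈ V ⊔ (I ^ (k + 1)).restrictScalars ℂ)
        (zero_mem _) (fun x y _ _ hx hy => add_mem hx hy) ?_ hf'
      rintro a x hx
      -- Modulo `I ^ (k + 1)` only the constant term of the coefficient `a` matters.
      obtain ⟨c, hc⟩ := exists_sub_algebraMap_mem a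
      have hax : a • x = c • x + (a - algebraMap ℂ S c) * x := by
        rw [smul_eq_mul, Algebra.smul_def]
        ring
      rw [hax]
      refine Submodule.add_mem_sup (Submodule.smul_mem _ c ?_) ?_
      · obtain ⟨i, j, hij, rfl⟩ := hx
        exact Submodule.subset_span
          ⟨⟨(⟨i, by omega⟩, ⟨j, by omega⟩), by simp only; omega⟩, rfl⟩
      · rw [Submodule.restrictScalars_mem, pow_succ']
        exact Ideal.mul_mem_mul hc (hI' (Ideal.subset_span hx))
  exact key (n + 1) le_rfl

/-- A parametrization of the standard exponents by the pairs `(k, j)` with `j + k ≤ n`: the point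
number `j` of the line `a - b = c` of rank `k`. -/
noncomputable def standardExponent (k j : ℕ) : Fin 2 →₀ ℕ :=
  if k % 2 = 1 then expo (j + (k + 1) / 2) j else expo (3 * (k / 2) + j) (4 * (k / 2) + j)

theorem isStandard_standardExponent {n k j : ℕ} (h : k + j ≤ n) :
    IsStandard n (standardExponent k j) := by
  unfold IsStandard InCone standardExponent
  split_ifs <;> simp only [expo_zero, expo_one] <;> omega

theorem standardExponent_injective {k j k' j' : ℕ}
    (h : standardExponent k j = standardExponent k' j') : k = k' ∧ j = j' := by
  have h0 := DFunLike.congr_fun h 0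
  have h1 := DFunLike.congr_fun h 1
  unfold standardExponent at h0 h1
  split_ifs at h0 h1 <;> simp only [expo_zero, expo_one] at h0 h1 <;> omega

/-- The combination of standard monomials with coefficients `c`. -/
noncomputable def standardComb (n : ℕ) (c : Triangle n → ℂ) : S :=
  ∑ d, c d • mono (standardExponent d.1.1 d.1.2) (isStandard_standardExponent d.2).1

theorem coeff_standardComb {n : ℕ} (c : Triangle n → ℂ) (α : Fin 2 →₀ ℕ) :
    coeff α (standardComb n c : Poly) =
      ∑ d, if standardExponent d.1.1 d.1.2 = α then c d else 0 := by
  simp [standardComb, mono, coeff_sum, coeff_monomial]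

theorem isStandard_of_mem_support_standardComb {n : ℕ} {c : Triangle n → ℂ} {α : Fin 2 →₀ ℕ}
    (h : α ∈ (standardComb n c : Poly).support) : IsStandard n α := by
  by_contra hα
  rw [mem_support_iff, coeff_standardComb] at h
  refine h (Finset.sum_eq_zero fun d _ => if_neg ?_)
  rintro rfl
  exact hα (isStandard_standardExponent d.2)

theorem eq_zero_of_mem_J_of_isStandard {n : ℕ} {f : S} (hf : f ∈ J n)
    (hs : ∀ α ∈ (f : Poly).support, IsStandard n α) : f = 0 :=
  Subtype.ext (eq_zero_of_support_isStandard (coe_mem_of_mem_J hf) hs)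

/-- The standard monomials are linearly independent modulo `J n`, and they are as many as the
products that span the quotient, so every element of `S` reduces to a combination of them. -/
theorem exists_sub_standardComb_mem_J (n : ℕ) (f : S) : ∃ c, f - standardComb n c ∈ J n := by
  let W : Submodule ℂ S := (J n).restrictScalars ℂ
  let b : Triangle n → S ⧸ W := fun d =>
    W.mkQ ((genX - 1) ^ (d.1.1 : ℕ) * (genZ - 1) ^ (d.1.2 : ℕ))
  let e : Triangle n → S ⧸ W := fun d =>
    W.mkQ (mono (standardExponent d.1.1 d.1.2) (isStandard_standardExponent d.2).1)
  have he : ∀ c : Triangle n → ℂ, ∑ d, c d • e d = W.mkQ (standardComb n c) := by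
    intro c
    simp only [e, standardComb, map_sum, map_smul]
  have hb : Submodule.span ℂ (Set.range b) = ⊤ := by
    have h := congrArg (Submodule.map W.mkQ) (span_products_sup_J n)
    rw [Submodule.map_sup, Submodule.map_span, ← Set.range_comp, Submodule.map_top,
      Submodule.range_mkQ, Submodule.mkQ_map_self, sup_bot_eq] at h
    exact h
  have : Module.Finite ℂ (S ⧸ W) := ⟨Submodule.fg_def.2 ⟨_, Set.finite_range b, hb⟩⟩
  have hli : LinearIndependent ℂ e := by
    rw [Fintype.linearIndependent_iff]
    intro c hc d
    rw [he, Submodule.mkQ_apply, Submodule.Quotient.mk_eq_zero] at hc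
    have h0 := eq_zero_of_mem_J_of_isStandard hc
      fun α hα => isStandard_of_mem_support_standardComb hα
    have h1 := coeff_standardComb c (standardExponent d.1.1 d.1.2)
    rw [h0, Finset.sum_eq_single d, if_pos rfl] at h1
    · simpa using h1.symm
    · intro d' _ hd'
      refine if_neg fun h => hd' ?_
      obtain ⟨h1, h2⟩ := standardExponent_injective h
      exact Subtype.ext (Prod.ext (Fin.ext h1) (Fin.ext h2))
    · simp
  have hcard : Fintype.card (Triangle n) = Module.finrank ℂ (S ⧸ W) := by
    refine le_antisymm hli.fintype_card_le_finrank ?_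
    have h := finrank_range_le_card (R := ℂ) b
    rwa [Set.finrank, hb, finrank_top] at h
  have hspan := hli.span_eq_top_of_card_eq_finrank' hcard
  have hf : W.mkQ f ∈ Submodule.span ℂ (Set.range e) := by rw [hspan]; trivial
  rw [Submodule.mem_span_range_iff_exists_fun] at hf
  obtain ⟨c, hc⟩ := hf
  rw [he] at hc
  exact ⟨c, (Submodule.Quotient.eq W).1 hc.symm⟩

/-! ### The reduced Gröbner basis -/

/-- `g` is an element of `J n` of the form `x^α` minus a combination of standard monomials. -/
structure IsReduction (n : ℕ) (α : Fin 2 →₀ ℕ) (g : S) : Prop where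
  mem : g ∈ J n
  coeff_eq_one : coeff α (g : Poly) = 1
  isStandard : ∀ β ∈ (g : Poly).support, β ≠ α → IsStandard n β

theorem exists_isReduction {n : ℕ} {α : Fin 2 →₀ ℕ} (hα : InCone α) (h : ¬ IsStandard n α) :
    ∃ g, IsReduction n α g := by
  obtain ⟨c, hc⟩ := exists_sub_standardComb_mem_J n (mono α hα)
  refine ⟨_, hc, ?_, fun β hβ hne => ?_⟩
  · have : α ∉ (standardComb n c : Poly).support :=
      fun h' => h (isStandard_of_mem_support_standardComb h')
    rw [Subalgebra.coe_sub, coeff_sub, notMem_support_iff.1 this]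
    simp [mono]
  · apply isStandard_of_mem_support_standardComb (c := c)
    rw [mem_support_iff, Subalgebra.coe_sub, coeff_sub] at hβ
    rw [mem_support_iff]
    intro h0
    rw [h0] at hβ
    simp [mono, coeff_monomial, hne.symm] at hβ

theorem IsReduction.isLeadingExponent {n : ℕ} {α : Fin 2 →₀ ℕ} {g : S} (h : IsReduction n α g)
    (hα : InCone α) (hα' : ¬ IsStandard n α) : IsLeadingExponent g α := by
  refine ⟨by rw [mem_support_iff, h.coeff_eq_one]; exact one_ne_zero, fun β hβ => ?_⟩
  rcases eq_or_ne β α with rfl | hne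
  · exact le_rfl
  · exact (weights_lt_of_isStandard (h.isStandard β hβ hne) hα hα').le

theorem IsReduction.unique {n : ℕ} {α : Fin 2 →₀ ℕ} {g g' : S} (h : IsReduction n α g)
    (h' : IsReduction n α g') : g = g' := by
  refine sub_eq_zero.1 (eq_zero_of_mem_J_of_isStandard (sub_mem h.mem h'.mem) fun β hβ => ?_)
  have hne : β ≠ α := by
    rintro rfl
    rw [mem_support_iff, Subalgebra.coe_sub, coeff_sub, h.coeff_eq_one, h'.coeff_eq_one,
      sub_self] at hβ
    exact hβ rfl
  rw [Subalgebra.coe_sub] at hβ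
  rcases Finset.mem_union.1 (support_sub _ _ _ hβ) with hβ | hβ
  exacts [h.isStandard β hβ hne, h'.isStandard β hβ hne]

/-- As the standard exponents form an initial segment of the cone, an element of `J n` with a
standard leading exponent is supported on standard exponents. -/
theorem not_isStandard_of_mem_J {n : ℕ} {f : S} (hf : f ∈ J n) {α : Fin 2 →₀ ℕ}
    (hα : IsLeadingExponent f α) : ¬ IsStandard n α := by
  intro hs
  have h0 : f = 0 := eq_zero_of_mem_J_of_isStandard hf fun β hβ => by
    by_contra hβ'
    exact (weights_lt_of_isStandard hs (inCone_of_mem_support f.2 hβ) hβ').not_ge (hα.2 β hβ)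
  have := hα.1
  simp [h0] at this

/-- The reductions of the corner exponents. -/
def reducedBasis (n : ℕ) : Set S := {g | ∃ ρ, IsCorner n (ρ 0) (ρ 1) ∧ IsReduction n ρ g}

theorem IsReduction.isLeadingExponent_of_isCorner {n : ℕ} {ρ : Fin 2 →₀ ℕ} {g : S}
    (h : IsReduction n ρ g) (hρ : IsCorner n (ρ 0) (ρ 1)) : IsLeadingExponent g ρ :=
  h.isLeadingExponent (inCone_of_isCorner hρ) (not_isStandard_of_isCorner hρ)

theorem exists_isReduction_of_isCorner {n : ℕ} {ρ : Fin 2 →₀ ℕ} (hρ : IsCorner n (ρ 0) (ρ 1)) :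
    ∃ g, IsReduction n ρ g :=
  exists_isReduction (inCone_of_isCorner hρ) (not_isStandard_of_isCorner hρ)

theorem leadingPoints_reducedBasis (n : ℕ) : leadingPoints (reducedBasis n) = P n := by
  ext x
  constructor
  · rintro ⟨g, ⟨ρ, hρ, hg⟩, α, hα, rfl⟩
    rw [hα.unique (hg.isLeadingExponent_of_isCorner hρ)]
    exact latticePoint_mem_P_iff.2 hρ
  · intro hx
    obtain ⟨ρ, rfl⟩ := exists_latticePoint_eq hx
    have hρ := latticePoint_mem_P_iff.1 hx
    obtain ⟨g, hg⟩ := exists_isReduction_of_isCorner hρ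
    exact ⟨g, ⟨ρ, hρ, hg⟩, ρ, hg.isLeadingExponent_of_isCorner hρ, rfl⟩

theorem finite_reducedBasis (n : ℕ) : (reducedBasis n).Finite := by
  have hP : (P n).Finite := Set.finite_of_ncard_ne_zero (by rw [ncard_P]; omega)
  have hinj : Function.Injective latticePoint := by
    intro α β h
    simp only [latticePoint, Prod.mk.injEq, Nat.cast_inj] at h
    exact exponent_ext h.1 h.2
  have hC : {ρ : Fin 2 →₀ ℕ | IsCorner n (ρ 0) (ρ 1)}.Finite :=
    (hP.preimage hinj.injOn).subset fun ρ hρ => latticePoint_mem_P_iff.2 hρ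
  refine (hC.biUnion (t := fun ρ => {g | IsReduction n ρ g}) fun ρ _ =>
    Set.Subsingleton.finite fun g hg g' hg' => IsReduction.unique hg hg').subset ?_
  rintro g ⟨ρ, hρ, hg⟩
  exact Set.mem_biUnion hρ hg

theorem isReducedGroebnerBasis_reducedBasis (n : ℕ) :
    IsReducedGroebnerBasis (J n) (reducedBasis n) where
  finite := finite_reducedBasis n
  mem := by
    rintro g ⟨ρ, hρ, hg⟩
    exact hg.mem
  ne_zero := by
    rintro g ⟨ρ, hρ, hg⟩ rfl
    simpa using hg.coeff_eq_one
  dvd := by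
    intro f hf hf0
    obtain ⟨β, hβ⟩ := exists_isLeadingExponent hf0
    obtain ⟨ρ, γ, hρ, hγ, he⟩ := exists_isCorner_add hβ.inCone (not_isStandard_of_mem_J hf hβ)
    obtain ⟨g, hg⟩ := exists_isReduction_of_isCorner hρ
    exact ⟨g, ⟨ρ, hρ, hg⟩, ρ, β, hg.isLeadingExponent_of_isCorner hρ, hβ,
      monomialDvd_iff.2 ⟨γ, hγ, he⟩⟩
  monic := by
    rintro g ⟨ρ, hρ, hg⟩ α hα
    rw [hα.unique (hg.isLeadingExponent_of_isCorner hρ)]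
    exact hg.coeff_eq_one
  reduced := by
    rintro g ⟨ρ, hρ, hg⟩ h ⟨σ, hσ, hh⟩ hne α hα β hβ hdvd
    rw [hα.unique (hh.isLeadingExponent_of_isCorner hσ)] at hdvd
    obtain ⟨γ, hγ, rfl⟩ := monomialDvd_iff.1 hdvd
    by_cases he : σ + γ = ρ
    · rw [← he] at hρ hg
      obtain rfl := eq_zero_of_isCorner_add hσ hγ hρ
      rw [add_zero] at hg
      exact hne (hh.unique hg)
    · exact not_isStandard_add (inCone_of_isCorner hσ) (not_isStandard_of_isCorner hσ) hγ
        (hg.isStandard _ hβ he)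

/-- In any reduced Gröbner basis each corner is a leading exponent, as nothing else in `J n` has a
leading monomial dividing it; by reducedness the leading exponents are the corners, and no
monomial other than the leading one can be non-standard. -/
theorem IsReducedGroebnerBasis.eq_reducedBasis {n : ℕ} {G : Set S}
    (hG : IsReducedGroebnerBasis (J n) G) : G = reducedBasis n := by
  have hcorner : ∀ ρ : Fin 2 →₀ ℕ, IsCorner n (ρ 0) (ρ 1) → ∃ g ∈ G, IsLeadingExponent g ρ := by
    intro ρ hρ
    obtain ⟨f, hf⟩ := exists_isReduction_of_isCorner hρ
    have hfρ := hf.isLeadingExponent_of_isCorner hρ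
    have hf0 : f ≠ 0 := by
      rintro rfl
      simpa using hf.coeff_eq_one
    obtain ⟨g, hg, α, β, hα, hβ, hdvd⟩ := hG.dvd f hf.mem hf0
    rw [hβ.unique hfρ] at hdvd
    obtain ⟨γ, hγ, rfl⟩ := monomialDvd_iff.1 hdvd
    obtain ⟨σ, δ, hσ, hδ, rfl⟩ :=
      exists_isCorner_add hα.inCone (not_isStandard_of_mem_J (hG.mem g hg) hα)
    have h0 : δ + γ = 0 := eq_zero_of_isCorner_add hσ (hδ.add hγ) (by rwa [← add_assoc])
    refine ⟨g, hg, ?_⟩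
    rw [add_assoc, h0, add_zero]
    rwa [(add_eq_zero.1 h0).1, add_zero] at hα
  -- A member of `G` with a monomial divisible by a corner has this corner as leading exponent.
  have hlead : ∀ g ∈ G, ∀ β ∈ (g : Poly).support, ¬ IsStandard n β →
      ∃ ρ γ, IsCorner n (ρ 0) (ρ 1) ∧ InCone γ ∧ β = ρ + γ ∧ IsLeadingExponent g ρ := by
    intro g hg β hβ hs
    obtain ⟨ρ, γ, hρ, hγ, he⟩ := exists_isCorner_add (inCone_of_mem_support g.2 hβ) hs
    obtain ⟨h, hh, hhρ⟩ := hcorner ρ hρ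
    have hgh : h = g := by
      by_contra hne
      exact hG.reduced g hg h hh hne ρ hhρ β hβ (monomialDvd_iff.2 ⟨γ, hγ, he⟩)
    exact ⟨ρ, γ, hρ, hγ, he, hgh ▸ hhρ⟩
  have hred : ∀ g ∈ G, ∀ ρ, IsLeadingExponent g ρ → IsReduction n ρ g := by
    intro g hg ρ hρ
    refine ⟨hG.mem g hg, hG.monic g hg ρ hρ, fun β hβ hne => ?_⟩
    by_contra hs
    obtain ⟨σ, γ, -, hγ, rfl, hgσ⟩ := hlead g hg β hβ hs
    obtain rfl := hρ.unique hgσ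
    exact (weights_lt_add hγ (by simpa using hne)).not_ge (hρ.2 _ hβ)
  ext g
  constructor
  · intro hg
    obtain ⟨α, hα⟩ := exists_isLeadingExponent (hG.ne_zero g hg)
    obtain ⟨ρ, -, hρ, -, -, hgρ⟩ :=
      hlead g hg α hα.1 (not_isStandard_of_mem_J (hG.mem g hg) hα)
    exact ⟨ρ, hρ, hred g hg ρ hgρ⟩
  · rintro ⟨ρ, hρ, hg⟩
    obtain ⟨h, hh, hhρ⟩ := hcorner ρ hρ
    rw [hg.unique (hred h hh ρ hhρ)]
    exact hh

theorem initialIdeal_J (n : ℕ) : initialIdeal (J n) = monomialIdeal (P n) := by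
  apply le_antisymm
  · refine Ideal.span_le.2 ?_
    rintro m ⟨f, hf, α, hα, hm⟩
    obtain ⟨ρ, γ, hρ, hγ, rfl⟩ := exists_isCorner_add hα.inCone (not_isStandard_of_mem_J hf hα)
    have he : m = mono γ hγ * mono ρ (inCone_of_isCorner hρ) := by
      apply Subtype.ext
      rw [hm]
      simp [mono, monomial_mul, add_comm]
    rw [he]
    exact Ideal.mul_mem_left _ _ (Ideal.subset_span ⟨ρ, latticePoint_mem_P_iff.2 hρ, rfl⟩)
  · refine Ideal.span_le.2 ?_
    rintro m ⟨ρ, hρ, hm⟩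
    have hρ' := latticePoint_mem_P_iff.1 hρ
    obtain ⟨g, hg⟩ := exists_isReduction_of_isCorner hρ'
    exact Ideal.subset_span ⟨g, hg.mem, ρ, hg.isLeadingExponent_of_isCorner hρ', hm⟩

end NashA3

theorem mainTheorem2 (n : ℕ) (hn : 0 < n) :
    (∃! G : Set NashA3.S, NashA3.IsReducedGroebnerBasis (NashA3.J n) G) ∧
    (∀ G : Set NashA3.S, NashA3.IsReducedGroebnerBasis (NashA3.J n) G →
      NashA3.leadingPoints G = NashA3.P n) ∧
    (NashA3.P n).ncard = n + 3 ∧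
    NashA3.initialIdeal (NashA3.J n) = NashA3.monomialIdeal (NashA3.P n) := by
  refine ⟨⟨NashA3.reducedBasis n, NashA3.isReducedGroebnerBasis_reducedBasis n,
    fun G hG => hG.eq_reducedBasis⟩, fun G hG => ?_, NashA3.ncard_P n,
    NashA3.initialIdeal_J n⟩
  rw [hG.eq_reducedBasis]
  exact NashA3.leadingPoints_reducedBasis n
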